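/- Let $\Xi=(\Xi_1,\dots,\Xi_d)$ have independent standard normal components, and let $\psi_1,\dots,\psi_P$, $P=\binom{d+p}{d}$, be the orthonormal probabilists' Hermite polynomials in $d$ variables of total degree at most $p$ (the products $\psi_{\mathbf i}(\xi)=\prod_k He_{i_k}(\xi_k)/\sqrt{i_k!}$ with $i_1+\dots+i_d\le p$). Let $\xi^{(1)},\dots,\xi^{(N)}$ be independent copies of $\Xi$, let $\Phi=N^{-1/2}\big(\psi_j(\xi^{(k)})\big)_{k\le N,\,j\le P}$ be the normalized measurement matrix, and let $\delta_s$ be its restricted isometry constant, the smallest number with $(1-\delta_s)\|y\|_2^2\le\|\Phi y\|_2^2\le(1+\delta_s)\|y\|_2^2$ for all $y\in\mathbb R^P$ with at most $s$ nonzero entries. For a measurable nonempty $Q\subseteq\mathbb R^d$ (the truncation set; where $\varepsilon_Q$ is used, with $\mathbb P(Q)>0$) write $\mathbb P(Q)=\mathbb P(\Xi\in Q)$, $\mu_Q=\sup_{j,\;\xi\in Q}|\psi_j(\xi)|^2\in[0,\infty]$ and $\varepsilon_Q=\big\|\mathbb E\big(X^TX\mid\Xi\in Q\big)-I\big\|_2$,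 where $X=(\psi_1(\Xi),\dots,\psi_P(\Xi))$ (spectral norm). For a constant $C_Q>0$ and a real number $t$ consider the following bounds (with the fractions read as $0$ if $\mu_Q=\infty$): $$\mathbb P(\delta_s<t)\ \ge\ \mathbb P(Q)^N-\exp\Big(-C_Q\frac{Nt}{s\mu_Q}+s+\log(2s)+s\log(P/s)\Big)\quad\text{for all } N\ge1,\ 1\le s\le P,\tag{1}$$ $$\mathbb P(\delta_P<t)\ \ge\ \mathbb P(Q)^N-2P\exp\Big(-C_Q\frac{Nt}{P\mu_Q}\Big)\quad\text{for all } N\ge1.\tag{2}$$ (a) There is a function $C(\varepsilon,\tau)>0$ of $0\le\varepsilon<\tau$, independent of $d,p,Q,N,s,t$, such that for all $d,p$, all $Q$ and all $\tau>\varepsilon_Q$ the bounds (1) and (2) hold with $C_Q=C(\varepsilon_Q,\tau)$ for every $t\ge\tau$. (b) For all $d,p$ and every $Q$ there is a constant $C_Q>0$, depending only on $d$, $p$ and $Q$, such that (1) and (2) hold for every real $t$. -/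

import Mathlib

open MeasureTheory ProbabilityTheory

noncomputable section

/-- Multi-indices `i = (i_1, …, i_d)` of total order `i_1 + ⋯ + i_d ≤ p`. (Each entry is then
automatically at most `p`, so the entries may be taken in `{0, …, p}`.) -/
abbrev MultiIndex (d p : ℕ) : Type :=
  {i : Fin d → Fin (p + 1) // ∑ k, (i k : ℕ) ≤ p}

/-- The number `P` of basis functions. -/
def numBasis (d p : ℕ) : ℕ := Fintype.card (MultiIndex d p)

/-- The law of the random input `Ξ`: `d` independent standard normal variables. -/
def inputLaw (d : ℕ) : Measure (Fin d → ℝ) :=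
  Measure.pi fun _ => gaussianReal 0 1

/-- The univariate orthonormal (probabilists') Hermite polynomial of degree `n`. -/
def hermiteON (n : ℕ) (x : ℝ) : ℝ :=
  Polynomial.aeval x (Polynomial.hermite n) / Real.sqrt (n.factorial : ℝ)

/-- The multivariate orthonormal Hermite polynomial with multi-index `i`. -/
def psi {d p : ℕ} (i : MultiIndex d p) (ξ : Fin d → ℝ) : ℝ :=
  ∏ k, hermiteON (i.1 k : ℕ) (ξ k)

/-- The measurement matrix `Ψ(k, j) = ψ_j(ξ^(k))` of the samples `ξ^(1), …, ξ^(N)`, normalized by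
`N^{-1/2}`, so that its Gramian is `M = N⁻¹ Ψᵀ Ψ`. -/
def sampledMatrix (d p : ℕ) {N : ℕ} (ξ : Fin N → Fin d → ℝ) :
    Matrix (Fin N) (MultiIndex d p) ℝ :=
  Matrix.of fun k j => psi j (ξ k) / Real.sqrt (N : ℝ)

/-- The restricted isometry constant `δ_s(Φ)`: the smallest `δ` such that
`(1 - δ) ‖y‖² ≤ ‖Φ y‖² ≤ (1 + δ) ‖y‖²` (Euclidean norms) for all `y` with at most `s` nonzero
entries. -/
def ric {m n : Type*} [Fintype m] [Fintype n] (s : ℕ) (Φ : Matrix m n ℝ) : ℝ :=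
  sInf {δ : ℝ | ∀ y : EuclideanSpace ℝ n, {j | y j ≠ 0}.ncard ≤ s →
    (1 - δ) * ‖y‖ ^ 2 ≤ ‖WithLp.toLp 2 (Φ.mulVec y.ofLp)‖ ^ 2 ∧
    ‖WithLp.toLp 2 (Φ.mulVec y.ofLp)‖ ^ 2 ≤ (1 + δ) * ‖y‖ ^ 2}

/-- The coherence `μ_Q = sup_{j, ξ ∈ Q} |ψ_j(ξ)|²`, possibly infinite. -/
def coherence (d p : ℕ) (Q : Set (Fin d → ℝ)) : ENNReal :=
  ⨆ ξ ∈ Q, ⨆ j : MultiIndex d p, ENNReal.ofReal (psi j ξ ^ 2)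

/-- The conditional Gramian `E(Xᵀ X | ξ ∈ Q)`, where `X = (ψ_j(ξ))_j` is a row vector. -/
def condGramian (d p : ℕ) (Q : Set (Fin d → ℝ)) :
    Matrix (MultiIndex d p) (MultiIndex d p) ℝ :=
  Matrix.of fun i j => ∫ ξ, psi i ξ * psi j ξ ∂(cond (inputLaw d) Q)

/-- The truncation bias `ε_Q = ‖E(Xᵀ X | ξ ∈ Q) - I‖₂` (spectral norm). -/
def truncBias (d p : ℕ) (Q : Set (Fin d → ℝ)) : ℝ :=
  ‖Matrix.toEuclideanCLM (n := MultiIndex d p) (𝕜 := ℝ) (condGramian d p Q - 1)‖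

/-- The probability `ℙ(δ_s < t)` for `N` independent samples of the input `Ξ`. -/
def probRicLT (d p N s : ℕ) (t : ℝ) : ℝ :=
  (Measure.pi fun _ : Fin N => inputLaw d).real {ξ | ric s (sampledMatrix d p ξ) < t}

/-- The probabilistic bounds on the restricted isometry constants, for the truncation set `Q`, the
constant `c` and the threshold `t`: the bound on `δ_s` for all `1 ≤ s ≤ P`, and the sharper bound
on `δ_P`, for every number `N ≥ 1` of samples. If `μ_Q = ∞` then `(coherence d p Q).toReal = 0`,
and the quotients by it are `0`, which is the value they have for `μ_Q = ∞`. -/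
def RicBound (d p : ℕ) (Q : Set (Fin d → ℝ)) (c t : ℝ) : Prop :=
  ∀ N : ℕ, 1 ≤ N →
    (∀ s : ℕ, 1 ≤ s → s ≤ numBasis d p →
      (inputLaw d).real Q ^ N
          - Real.exp (-(c * ((N * t) / (s * (coherence d p Q).toReal)))
              + s + Real.log (2 * s) + s * Real.log ((numBasis d p : ℝ) / s))
        ≤ probRicLT d p N s t) ∧
    (inputLaw d).real Q ^ N
        - 2 * (numBasis d p : ℝ)
          * Real.exp (-(c * ((N * t) / (numBasis d p * (coherence d p Q).toReal))))
      ≤ probRicLT d p N (numBasis d p) t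

end

/-! ### Trace inequalities for powers of matrices -/

namespace Matrix

open scoped Matrix

variable {n : Type*} [Fintype n] [DecidableEq n]

/-! Instead of conditioning on all samples lying in `Q`, restrict the input law to `Q`. The `N`-fold
product of the restricted law has total mass `ℙ(Q)^N`, so it suffices to bound the mass of the
samples with `δ_s ≥ t`.

For a fixed support `S` of size `s` and a sign `σ = ±1`, the vectors `x = (ψ_j(ξ))_{j ∈ S}` satisfy
`‖x‖² ≤ R = s μ_Q`, and their conditional second moment is within `ε_Q` of the identity. The
Ahlswede-Winter method applies: Golden-Thompson (`IsSymm.trace_exp_add_le`) peels the samples off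
`tr exp(c ∑ x xᵀ)` one at a time, and Markov's inequality yields the exceptional set of
`exists_exceptional_set`. A union bound over the two signs and the `P.choose s` supports
(`pow_sub_le_probRicLT`) gives both bounds, the second because `s = P` leaves a single support.
Optimizing the Laplace parameter for `t ≥ τ > ε_Q` gives (a).

For (b), `t ≥ ε_Q + 1` falls under (a) and `t ≤ 0` is trivial. In between, if `ℙ(Q) < 1`, then
`ℙ(Q)^N` itself decays exponentially and a small constant makes the subtracted term dominate. If
`ℙ(Q) = 1`, then `μ_Q = ∞`, unless the basis is the constant `1` and `Φ` is an isometry. -/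

theorem trace_mul_pow_comm (A B : Matrix n n ℝ) (m : ℕ) :
    ((A * B) ^ m).trace = ((B * A) ^ m).trace := by
  cases m with
  | zero => simp
  | succ m =>
    have h : ∀ k : ℕ, (A * B) ^ k * A = A * (B * A) ^ k := fun k => by
      induction k with
      | zero => simp
      | succ k ih => rw [pow_succ', mul_assoc, ih, pow_succ']; simp only [mul_assoc]
    rw [pow_succ, ← mul_assoc, h, mul_assoc, trace_mul_comm, mul_assoc, ← pow_succ]

theorem trace_transpose_mul_self_nonneg {n : Type*} [Fintype n] (A : Matrix n n ℝ) : 0 ≤ (Aᵀ * A).trace := by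
  simp only [trace, diag_apply, mul_apply, transpose_apply]
  exact Finset.sum_nonneg fun i _ => Finset.sum_nonneg fun j _ => mul_self_nonneg _

theorem trace_sq_le_trace_transpose_mul_self (A : Matrix n n ℝ) :
    (A ^ 2).trace ≤ (Aᵀ * A).trace := by
  have h := trace_transpose_mul_self_nonneg (A - Aᵀ)
  have h1 : (Aᵀ * Aᵀ).trace = (A * A).trace := by
    rw [← transpose_mul, trace_transpose]
  have h2 : (A * Aᵀ).trace = (Aᵀ * A).trace := trace_mul_comm _ _
  simp only [transpose_sub, transpose_transpose, sub_mul, mul_sub, trace_sub, h1, h2] at h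
  rw [sq]
  linarith

theorem IsSymm.two_mul_trace_mul_le {U V : Matrix n n ℝ} (hU : U.IsSymm) (hV : V.IsSymm) :
    2 * (U * V).trace ≤ (U ^ 2).trace + (V ^ 2).trace := by
  have h := trace_transpose_mul_self_nonneg (U - V)
  have h1 : (V * U).trace = (U * V).trace := trace_mul_comm _ _
  simp only [transpose_sub, hU.eq, hV.eq, sub_mul, mul_sub, trace_sub, h1] at h
  rw [sq, sq]
  linarith

/-- The two claims feed each other. The first at `k + 1` is the first at `k` for `Y²`, then the
second at `k` for `YᵀY` and `YYᵀ`, whose powers have equal traces. The second at `k + 1` is the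
first at `k` for `UV`, then the second at `k` for `U²` and `V²`. -/
theorem trace_two_pow_inequalities (k : ℕ) :
    (∀ Y : Matrix n n ℝ, (Y ^ 2 ^ (k + 1)).trace ≤ ((Yᵀ * Y) ^ 2 ^ k).trace) ∧
    (∀ U V : Matrix n n ℝ, U.IsSymm → V.IsSymm →
      ((U * V) ^ 2 ^ k).trace ≤ (U ^ 2 ^ k * V ^ 2 ^ k).trace) := by
  induction k with
  | zero =>
    refine ⟨fun Y => ?_, fun U V _ _ => ?_⟩
    · simpa using trace_sq_le_trace_transpose_mul_self Y
    · simp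
  | succ k ih =>
    obtain ⟨hL, hM⟩ := ih
    refine ⟨fun Y => ?_, fun U V hU hV => ?_⟩
    · have e1 : Y ^ 2 ^ (k + 1 + 1) = (Y ^ 2) ^ 2 ^ (k + 1) := by
        rw [← pow_mul, ← pow_succ']
      have e2 : (((Y ^ 2)ᵀ * Y ^ 2) ^ 2 ^ k).trace
          = (((Yᵀ * Y) * (Y * Yᵀ)) ^ 2 ^ k).trace := by
        have : (Y ^ 2)ᵀ * Y ^ 2 = Yᵀ * (Yᵀ * Y * Y) := by
          rw [sq, transpose_mul]; simp only [mul_assoc]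
        rw [this, trace_mul_pow_comm]; simp only [mul_assoc]
      have hU : (Yᵀ * Y).IsSymm := by simp [IsSymm]
      have hV : (Y * Yᵀ).IsSymm := by simp [IsSymm]
      have e3 : ((Y * Yᵀ) ^ 2 ^ (k + 1)).trace = ((Yᵀ * Y) ^ 2 ^ (k + 1)).trace :=
        trace_mul_pow_comm _ _ _
      have h3 := (hU.pow (2 ^ k)).two_mul_trace_mul_le (hV.pow (2 ^ k))
      rw [← pow_mul, ← pow_mul, ← pow_succ, e3] at h3
      calc (Y ^ 2 ^ (k + 1 + 1)).trace ≤ (((Y ^ 2)ᵀ * Y ^ 2) ^ 2 ^ k).trace := by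
            rw [e1]; exact hL _
        _ ≤ ((Yᵀ * Y) ^ 2 ^ k * (Y * Yᵀ) ^ 2 ^ k).trace := by rw [e2]; exact hM _ _ hU hV
        _ ≤ _ := by linarith
    · have e2 : (((U * V)ᵀ * (U * V)) ^ 2 ^ k).trace = ((U ^ 2 * V ^ 2) ^ 2 ^ k).trace := by
        have : (U * V)ᵀ * (U * V) = V * (U ^ 2 * V) := by
          rw [transpose_mul, hU.eq, hV.eq, sq]; simp only [mul_assoc]
        rw [this, trace_mul_pow_comm, mul_assoc, ← sq]
      calc ((U * V) ^ 2 ^ (k + 1)).trace ≤ (((U * V)ᵀ * (U * V)) ^ 2 ^ k).trace := hL _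
        _ ≤ ((U ^ 2) ^ 2 ^ k * (V ^ 2) ^ 2 ^ k).trace := by
            rw [e2]; exact hM _ _ (hU.pow 2) (hV.pow 2)
        _ = _ := by rw [← pow_mul, ← pow_mul, ← pow_succ']

end Matrix

/-! ### The Lie product formula and the Golden-Thompson inequality -/

section LieProduct

theorem norm_pow_succ_sub_pow_succ_le {𝔸 : Type*} [NormedRing 𝔸] {x y : 𝔸} {M : ℝ} (hx : ‖x‖ ≤ M) (hy : ‖y‖ ≤ M) (m : ℕ) :
    ‖x ^ (m + 1) - y ^ (m + 1)‖ ≤ (m + 1) * M ^ m * ‖x - y‖ := by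
  have hM : 0 ≤ M := (norm_nonneg x).trans hx
  induction m with
  | zero => simp
  | succ m ih =>
    have e : x ^ (m + 1 + 1) - y ^ (m + 1 + 1)
        = x ^ (m + 1) * (x - y) + (x ^ (m + 1) - y ^ (m + 1)) * y := by
      rw [pow_succ x (m + 1), pow_succ y (m + 1)]; noncomm_ring
    have h1 : ‖x ^ (m + 1)‖ ≤ M ^ (m + 1) :=
      (norm_pow_le' x m.succ_pos).trans (pow_le_pow_left₀ (norm_nonneg _) hx _)
    calc _ ≤ ‖x ^ (m + 1)‖ * ‖x - y‖ + ‖x ^ (m + 1) - y ^ (m + 1)‖ * ‖y‖ := by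
          rw [e]; exact (norm_add_le _ _).trans (add_le_add (norm_mul_le _ _) (norm_mul_le _ _))
      _ ≤ M ^ (m + 1) * ‖x - y‖ + ((m + 1) * M ^ m * ‖x - y‖) * M := by gcongr
      _ = _ := by push_cast; ring

variable {𝔸 : Type*} [NormedRing 𝔸] [NormedAlgebra ℝ 𝔸] [NormOneClass 𝔸]

theorem NormedSpace.norm_exp_le_exp_norm (x : 𝔸) : ‖NormedSpace.exp x‖ ≤ Real.exp ‖x‖ := by
  have hs : Summable fun n : ℕ => ((n.factorial : ℝ)⁻¹) • ‖x‖ ^ n :=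
    NormedSpace.expSeries_summable' (𝕂 := ℝ) ‖x‖
  have hle : ∀ n : ℕ, ‖((n.factorial : ℝ)⁻¹) • x ^ n‖ ≤ ((n.factorial : ℝ)⁻¹) • ‖x‖ ^ n := by
    intro n
    rw [norm_smul, Real.norm_of_nonneg (by positivity), smul_eq_mul]
    gcongr
    exact norm_pow_le x n
  rw [Real.exp_eq_exp_ℝ, NormedSpace.exp_eq_tsum ℝ, NormedSpace.exp_eq_tsum ℝ]
  exact tsum_of_norm_bounded hs.hasSum hle

/-- At `r = 1/(m+1)` the factors `e^{rA} e^{rB}` and `e^{r(A+B)}` differ by `o(r)`, having the same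
derivative at `0`; telescoping the `(m+1)`-th powers costs only a factor `O(1/r)`. -/
theorem tendsto_exp_mul_exp_pow [CompleteSpace 𝔸] (A B : 𝔸) :
    Filter.Tendsto (fun m : ℕ => (NormedSpace.exp ((1 / ((m : ℝ) + 1)) • A) *
      NormedSpace.exp ((1 / ((m : ℝ) + 1)) • B)) ^ (m + 1)) Filter.atTop
      (nhds (NormedSpace.exp (A + B))) := by
  have hA := hasDerivAt_exp_smul_const (𝕂 := ℝ) A (0 : ℝ)
  have hB := hasDerivAt_exp_smul_const (𝕂 := ℝ) B (0 : ℝ)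
  have hAB := hasDerivAt_exp_smul_const (𝕂 := ℝ) (A + B) (0 : ℝ)
  have hd := (hA.mul hB).sub hAB
  simp only [zero_smul, NormedSpace.exp_zero, one_mul, mul_one, sub_self] at hd
  have ht : Filter.Tendsto (fun m : ℕ => 1 / ((m : ℝ) + 1)) Filter.atTop (nhdsWithin 0 {0}ᶜ) :=
    tendsto_nhdsWithin_iff.2 ⟨tendsto_one_div_add_atTop_nhds_zero_nat,
      Filter.Eventually.of_forall fun m => by
        simp only [Set.mem_compl_iff, Set.mem_singleton_iff]; positivity⟩
  have h0 := (hd.tendsto_slope_zero.comp ht).norm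
  simp only [Function.comp_def, zero_add, norm_zero, Pi.sub_apply, Pi.mul_apply, zero_smul,
    NormedSpace.exp_zero, one_mul, sub_self, sub_zero, norm_smul] at h0
  set K := Real.exp (‖A‖ + ‖B‖)
  have h1 := h0.mul_const K
  rw [zero_mul] at h1
  rw [tendsto_iff_norm_sub_tendsto_zero]
  refine squeeze_zero (fun _ => norm_nonneg _) (fun m => ?_) h1
  set r : ℝ := 1 / ((m : ℝ) + 1) with hr
  have hr0 : 0 ≤ r := by positivity
  have hrm : ((m + 1 : ℕ) : ℝ) * r = 1 := by rw [hr]; push_cast; field_simp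
  have e : NormedSpace.exp (A + B) = NormedSpace.exp (r • (A + B)) ^ (m + 1) := by
    let := NormedAlgebra.restrictScalars ℚ ℝ 𝔸
    rw [← NormedSpace.exp_nsmul, ← Nat.cast_smul_eq_nsmul ℝ, smul_smul, hrm, one_smul]
  set M := Real.exp (r * (‖A‖ + ‖B‖)) with hM
  have hx : ‖NormedSpace.exp (r • A) * NormedSpace.exp (r • B)‖ ≤ M := by
    refine (norm_mul_le _ _).trans ?_
    rw [hM, mul_add, Real.exp_add]
    refine mul_le_mul ?_ ?_ (norm_nonneg _) (Real.exp_nonneg _)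
    · simpa [norm_smul, abs_of_nonneg hr0] using NormedSpace.norm_exp_le_exp_norm (r • A)
    · simpa [norm_smul, abs_of_nonneg hr0] using NormedSpace.norm_exp_le_exp_norm (r • B)
  have hy : ‖NormedSpace.exp (r • (A + B))‖ ≤ M := by
    refine (NormedSpace.norm_exp_le_exp_norm _).trans (Real.exp_le_exp.2 ?_)
    rw [norm_smul, Real.norm_of_nonneg hr0]
    gcongr
    exact norm_add_le _ _
  have hMK : M ^ m ≤ K := by
    rw [hM, ← Real.exp_nat_mul]
    refine Real.exp_le_exp.2 ?_
    have : (m : ℝ) * r ≤ 1 := by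
      rw [← hrm]; gcongr; simp
    calc (m : ℝ) * (r * (‖A‖ + ‖B‖)) = (m * r) * (‖A‖ + ‖B‖) := by ring
      _ ≤ 1 * (‖A‖ + ‖B‖) := by gcongr
      _ = _ := one_mul _
  have hri : ‖r⁻¹‖ = (m : ℝ) + 1 := by
    rw [Real.norm_of_nonneg (by positivity), hr, one_div, inv_inv]
  rw [e]
  refine (norm_pow_succ_sub_pow_succ_le hx hy m).trans ?_
  rw [hri]
  calc _ ≤ (m + 1) * K * ‖NormedSpace.exp (r • A) * NormedSpace.exp (r • B)
        - NormedSpace.exp (r • (A + B))‖ := by gcongr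
    _ = _ := by ring

end LieProduct

namespace Matrix

open scoped Matrix Matrix.Norms.Operator

variable {n : Type*} [Fintype n] [DecidableEq n]

theorem continuous_exp : Continuous (NormedSpace.exp : Matrix n n ℝ → Matrix n n ℝ) :=
  NormedSpace.exp_continuous

/-- The **Golden-Thompson inequality** for real symmetric matrices. -/
theorem IsSymm.trace_exp_add_le {A B : Matrix n n ℝ} (hA : A.IsSymm) (hB : B.IsSymm) :
    (NormedSpace.exp (A + B)).trace ≤ (NormedSpace.exp A * NormedSpace.exp B).trace := by
  cases isEmpty_or_nonempty n
  · simp [trace]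
  -- The trace inequality is known for exponents `2 ^ k` only, so the limit is taken along `m + 1 =
  -- 2 ^ k`.
  have ht : Filter.Tendsto (fun k : ℕ => 2 ^ k - 1) Filter.atTop Filter.atTop :=
    (Filter.tendsto_sub_atTop_nat 1).comp (tendsto_pow_atTop_atTop_of_one_lt one_lt_two)
  have h := (continuous_id.matrix_trace.tendsto _).comp
    ((tendsto_exp_mul_exp_pow A B).comp ht)
  refine le_of_tendsto h (Filter.Eventually.of_forall fun k => ?_)
  have hk : 2 ^ k - 1 + 1 = 2 ^ k := Nat.sub_add_cancel Nat.one_le_two_pow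
  have hk' : (((2 ^ k - 1 : ℕ) : ℝ) + 1) = ((2 ^ k : ℕ) : ℝ) := by rw [← hk]; push_cast; simp
  have hpow : ∀ X : Matrix n n ℝ,
      NormedSpace.exp ((1 / ((2 ^ k : ℕ) : ℝ)) • X) ^ 2 ^ k = NormedSpace.exp X := fun X => by
    rw [← Matrix.exp_nsmul, ← Nat.cast_smul_eq_nsmul ℝ, smul_smul, mul_one_div_cancel, one_smul]
    positivity
  simp only [Function.comp_apply, id, hk, hk']
  refine ((trace_two_pow_inequalities k).2 _ _ (hA.smul _).exp (hB.smul _).exp).trans_eq ?_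
  rw [hpow, hpow]

end Matrix

/-! ### Quadratic forms of matrix exponentials -/

namespace Matrix

open scoped Matrix

variable {n : Type*} [Fintype n] [DecidableEq n]

/-- Simultaneous diagonalization of the quadratic forms of a symmetric matrix and of its
exponential. -/
theorem IsSymm.exists_diagonalization_exp {A : Matrix n n ℝ} (hA : A.IsSymm) :
    ∃ (ev : n → ℝ) (u : n → n → ℝ),
      (∀ i, u i ⬝ᵥ u i = 1) ∧
      (∀ i, A *ᵥ u i = ev i • u i) ∧
      (∀ y, y ⬝ᵥ y = ∑ i, (u i ⬝ᵥ y) ^ 2) ∧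
      (∀ y, y ⬝ᵥ A *ᵥ y = ∑ i, ev i * (u i ⬝ᵥ y) ^ 2) ∧
      (∀ (c : ℝ) (y), y ⬝ᵥ NormedSpace.exp (c • A) *ᵥ y
        = ∑ i, Real.exp (c * ev i) * (u i ⬝ᵥ y) ^ 2) ∧
      (NormedSpace.exp A).trace = ∑ i, Real.exp (ev i) := by
  have hH : A.IsHermitian := by rw [IsHermitian, conjTranspose_eq_transpose_of_trivial]; exact hA
  set ev := hH.eigenvalues
  set U : Matrix n n ℝ := (hH.eigenvectorUnitary : Matrix n n ℝ)
  have hUU : Uᵀ * U = 1 := by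
    have := Unitary.coe_star_mul_self hH.eigenvectorUnitary
    rwa [star_eq_conjTranspose, conjTranspose_eq_transpose_of_trivial] at this
  have hUU' : U * Uᵀ = 1 := mul_eq_one_comm.1 hUU
  have hinv : U⁻¹ = Uᵀ := inv_eq_left_inv hUU
  have hdiag : A = U * diagonal ev * Uᵀ := by
    have := hH.spectral_theorem
    rwa [Unitary.conjStarAlgAut_apply, star_eq_conjTranspose,
      conjTranspose_eq_transpose_of_trivial] at this
  have hexp : ∀ c : ℝ, NormedSpace.exp (c • A)
      = U * diagonal (fun i => Real.exp (c * ev i)) * Uᵀ := fun c => by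
    have : c • A = U * diagonal (c • ev) * U⁻¹ := by
      rw [hinv, hdiag, diagonal_smul, mul_smul_comm, smul_mul_assoc]
    rw [this, exp_conj _ _ (IsUnit.of_mul_eq_one _ hUU'), hinv, exp_diagonal]
    congr 3
    ext i
    rw [Pi.coe_exp, Real.exp_eq_exp_ℝ]; rfl
  have hquad : ∀ (v : n → ℝ) (y : n → ℝ), y ⬝ᵥ (U * diagonal v * Uᵀ) *ᵥ y
      = ∑ i, v i * (Uᵀ i ⬝ᵥ y) ^ 2 := fun v y => by
    rw [← mulVec_mulVec, ← mulVec_mulVec, dotProduct_mulVec, ← mulVec_transpose]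
    simp only [dotProduct, mulVec_diagonal]
    refine Finset.sum_congr rfl fun i _ => ?_
    simp only [mulVec, dotProduct]; ring
  refine ⟨ev, fun i => Uᵀ i, fun i => ?_, fun i => ?_, fun y => ?_, fun y => ?_,
    fun c y => ?_, ?_⟩
  · have := congrFun (congrFun hUU i) i
    simpa [mul_apply, dotProduct] using this
  · exact hH.mulVec_eigenvectorBasis i
  · have := hquad (fun _ => 1) y
    simpa [hUU'] using this
  · conv_lhs => rw [hdiag]
    exact hquad ev y
  · rw [hexp, hquad]
  · have := hexp 1
    simp only [one_smul, one_mul] at this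
    rw [this, trace_mul_comm, ← mul_assoc, hUU, one_mul, trace_diagonal]

theorem IsSymm.trace_exp_pos [Nonempty n] {A : Matrix n n ℝ} (hA : A.IsSymm) :
    0 < (NormedSpace.exp A).trace := by
  obtain ⟨ev, u, -, -, -, -, -, h⟩ := hA.exists_diagonalization_exp
  rw [h]
  exact Finset.sum_pos (fun _ _ => Real.exp_pos _) Finset.univ_nonempty

/-- Each eigenvalue `λ` satisfies `e^λ ≤ tr e^A`. -/
theorem IsSymm.dotProduct_mulVec_le_log_trace_exp {A : Matrix n n ℝ} (hA : A.IsSymm)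
    (y : n → ℝ) : y ⬝ᵥ A *ᵥ y ≤ Real.log (NormedSpace.exp A).trace * (y ⬝ᵥ y) := by
  obtain ⟨ev, u, -, -, h1, h2, -, h⟩ := hA.exists_diagonalization_exp
  rw [h1, h2, h, Finset.mul_sum]
  refine Finset.sum_le_sum fun i _ => mul_le_mul_of_nonneg_right ?_ (sq_nonneg _)
  have hle : Real.exp (ev i) ≤ ∑ j, Real.exp (ev j) :=
    Finset.single_le_sum (f := fun j => Real.exp (ev j)) (fun j _ => (Real.exp_pos _).le)
      (Finset.mem_univ i)
  exact (Real.le_log_iff_exp_le ((Real.exp_pos _).trans_le hle)).2 hle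

theorem isSymm_vecMulVec_self {n : Type*} (x : n → ℝ) : (vecMulVec x x).IsSymm := by
  ext i j; simp [vecMulVec_apply, mul_comm]

theorem dotProduct_vecMulVec_self_mulVec {n : Type*} [Fintype n] (x y : n → ℝ) :
    y ⬝ᵥ vecMulVec x x *ᵥ y = (x ⬝ᵥ y) ^ 2 := by
  rw [vecMulVec_mulVec, dotProduct_comm]; simp [sq]

/-- A quadratic form of the exponential of a rank-one matrix is at most its chord. -/
theorem dotProduct_exp_smul_vecMulVec_mulVec_le {c R : ℝ} (hR : 0 < R) {x : n → ℝ}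
    (hx : x ⬝ᵥ x ≤ R) (y : n → ℝ) :
    y ⬝ᵥ NormedSpace.exp (c • vecMulVec x x) *ᵥ y
      ≤ y ⬝ᵥ y + (Real.exp (c * R) - 1) / R * (x ⬝ᵥ y) ^ 2 := by
  obtain ⟨ev, u, h0, hev, h1, h2, h3, -⟩ := (isSymm_vecMulVec_self x).exists_diagonalization_exp
  rw [h3, h1, ← dotProduct_vecMulVec_self_mulVec, h2, Finset.mul_sum, ← Finset.sum_add_distrib]
  refine Finset.sum_le_sum fun i _ => ?_
  rw [← mul_assoc, ← one_add_mul]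
  refine mul_le_mul_of_nonneg_right ?_ (sq_nonneg _)
  have hevi : ev i = (x ⬝ᵥ u i) ^ 2 := by
    rw [← dotProduct_vecMulVec_self_mulVec, hev, dotProduct_smul, h0, smul_eq_mul, mul_one]
  have hl0 : 0 ≤ ev i := by rw [hevi]; positivity
  have hlR : ev i ≤ R := by
    have hcs : (x ⬝ᵥ u i) ^ 2 ≤ (x ⬝ᵥ x) * (u i ⬝ᵥ u i) := by
      simpa [dotProduct, ← sq] using
        Finset.sum_mul_sq_le_sq_mul_sq Finset.univ x (u i)
    rw [h0, mul_one, ← hevi] at hcs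
    exact hcs.trans hx
  -- Convexity of `exp` between `0` and `c * R`; `c` may have either sign.
  have hc := convexOn_exp.2 (Set.mem_univ 0) (Set.mem_univ (c * R))
    (sub_nonneg.2 ((div_le_one hR).2 hlR)) (div_nonneg hl0 hR.le) (sub_add_cancel _ _)
  simp only [smul_eq_mul, mul_zero, zero_add, Real.exp_zero, mul_one] at hc
  have e : ev i / R * (c * R) = c * ev i := by field_simp
  rw [e] at hc
  refine hc.trans_eq ?_
  field_simp
  ring

/-- With `K = exp(H/2)` symmetric, `tr(e^H E) = tr(K E K)`. This reduces trace estimates to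
quadratic forms, where the second-moment hypothesis applies. -/
theorem IsSymm.exists_trace_exp_mul_eq_sum {H : Matrix n n ℝ} (hH : H.IsSymm) :
    ∃ k : n → n → ℝ, ∀ E : Matrix n n ℝ,
      (NormedSpace.exp H * E).trace = ∑ i, k i ⬝ᵥ E *ᵥ k i := by
  set K := NormedSpace.exp ((1 / 2 : ℝ) • H)
  have hK : K.IsSymm := (hH.smul _).exp
  have hKK : NormedSpace.exp H = K * K := by
    rw [← exp_add_of_commute _ _ (Commute.refl _), ← add_smul]
    norm_num
  refine ⟨fun i => K i, fun E => ?_⟩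
  rw [hKK, mul_assoc, trace_mul_comm]
  have : K * E * K = K * (E * Kᵀ) := by rw [hK.eq, mul_assoc]
  rw [this]
  simp only [trace, diag_apply]
  refine Finset.sum_congr rfl fun i _ => ?_
  simp [mul_apply, dotProduct, mulVec, transpose_apply]

end Matrix

/-! ### A matrix Chernoff bound for sums of independent rank-one matrices -/

namespace Matrix

open scoped Matrix

variable {n : Type*} [Fintype n] [DecidableEq n]

theorem IsSymm.trace_exp_nonneg {A : Matrix n n ℝ} (hA : A.IsSymm) :
    0 ≤ (NormedSpace.exp A).trace := by
  cases isEmpty_or_nonempty n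
  · simp [trace]
  · exact hA.trace_exp_pos.le

theorem isSymm_sum_smul_vecMulVec_self {ι n : Type*} (s : Finset ι) (c : ℝ) (x : ι → n → ℝ) :
    (∑ k ∈ s, c • vecMulVec (x k) (x k)).IsSymm := by
  ext i j
  simp [sum_apply, vecMulVec_apply, mul_comm]

end Matrix

section Chernoff

open Matrix

open scoped Matrix

variable {n Ω : Type*} [Fintype n] [MeasurableSpace Ω] {ν : Measure Ω} {x : Ω → n → ℝ}

theorem integrable_dotProduct_sq [IsFiniteMeasure ν] (hx : Measurable x) {R : ℝ}
    (hb : ∀ᵐ ω ∂ν, x ω ⬝ᵥ x ω ≤ R) (v : n → ℝ) :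
    Integrable (fun ω => (x ω ⬝ᵥ v) ^ 2) ν := by
  refine Integrable.of_bound (C := R * (v ⬝ᵥ v)) (Measurable.aestronglyMeasurable ?_) ?_
  · simp only [dotProduct]; fun_prop
  · filter_upwards [hb] with ω hω
    rw [Real.norm_of_nonneg (sq_nonneg _)]
    have hcs : (x ω ⬝ᵥ v) ^ 2 ≤ (x ω ⬝ᵥ x ω) * (v ⬝ᵥ v) := by
      simpa [dotProduct, ← sq] using Finset.sum_mul_sq_le_sq_mul_sq Finset.univ (x ω) v
    refine hcs.trans (mul_le_mul_of_nonneg_right hω ?_)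
    exact Finset.sum_nonneg fun i _ => mul_self_nonneg _

variable [DecidableEq n]

/-- Cost of one sample. Golden-Thompson separates it from `H`, and the chord bound is affine in `x
xᵀ`, so only the second moment enters. The measure is a sub-probability, so that the restricted law
can be used; the lower integral avoids proving integrability of the left side. -/
theorem lintegral_trace_exp_add_le [IsFiniteMeasure ν] (hν : ν.real Set.univ ≤ 1)
    (hx : Measurable x) {R ε : ℝ} (hR : 0 < R) (hb : ∀ᵐ ω ∂ν, x ω ⬝ᵥ x ω ≤ R)
    (hcov : ∀ v : n → ℝ, |∫ ω, (x ω ⬝ᵥ v) ^ 2 ∂ν - ν.real Set.univ * (v ⬝ᵥ v)|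
      ≤ ν.real Set.univ * (ε * (v ⬝ᵥ v))) {c κ : ℝ} (hκ : κ = (Real.exp (c * R) - 1) / R)
    {H : Matrix n n ℝ} (hH : H.IsSymm) :
    ∫⁻ ω, ENNReal.ofReal (NormedSpace.exp (H + c • vecMulVec (x ω) (x ω))).trace ∂ν
      ≤ ENNReal.ofReal (Real.exp (κ + |κ| * ε))
        * ENNReal.ofReal (NormedSpace.exp H).trace := by
  obtain ⟨k, hk⟩ := hH.exists_trace_exp_mul_eq_sum
  have htr : (NormedSpace.exp H).trace = ∑ i, k i ⬝ᵥ k i := by simpa using hk 1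
  have hsymm : ∀ ω, (c • vecMulVec (x ω) (x ω)).IsSymm := fun ω =>
    (isSymm_vecMulVec_self _).smul c
  have hpt : ∀ᵐ ω ∂ν, (NormedSpace.exp (H + c • vecMulVec (x ω) (x ω))).trace
      ≤ ∑ i, (k i ⬝ᵥ k i + κ * (x ω ⬝ᵥ k i) ^ 2) := by
    filter_upwards [hb] with ω hω
    refine (hH.trace_exp_add_le (hsymm ω)).trans ?_
    rw [hk]
    refine Finset.sum_le_sum fun i _ => ?_
    rw [hκ]
    exact dotProduct_exp_smul_vecMulVec_mulVec_le hR hω _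
  have hint : ∀ i, Integrable (fun ω => k i ⬝ᵥ k i + κ * (x ω ⬝ᵥ k i) ^ 2) ν := fun i =>
    (integrable_const _).add ((integrable_dotProduct_sq hx hb _).const_mul κ)
  refine (lintegral_mono_ae (hpt.mono fun ω h => ENNReal.ofReal_le_ofReal h)).trans ?_
  rw [← ofReal_integral_eq_lintegral_ofReal (integrable_finsetSum _ fun i _ => hint i)
    (hpt.mono fun ω h => (hH.add (hsymm ω)).trace_exp_nonneg.trans h),
    ← ENNReal.ofReal_mul (Real.exp_nonneg _), integral_finsetSum _ fun i _ => hint i]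
  refine ENNReal.ofReal_le_ofReal ?_
  rw [htr, Finset.mul_sum]
  refine Finset.sum_le_sum fun i _ => ?_
  rw [integral_add (integrable_const _) ((integrable_dotProduct_sq hx hb _).const_mul κ),
    integral_const, integral_const_mul, smul_eq_mul]
  set q := ν.real Set.univ
  set J := ∫ ω, (x ω ⬝ᵥ k i) ^ 2 ∂ν
  set a := k i ⬝ᵥ k i
  have ha : 0 ≤ a := Finset.sum_nonneg fun i _ => mul_self_nonneg _
  have hq : 0 ≤ q := measureReal_nonneg
  have h1 : κ * (J - q * a) ≤ |κ| * (q * (ε * a)) :=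
    (le_abs_self _).trans (by rw [abs_mul]; gcongr; exact hcov _)
  have h2 : 1 + (κ + |κ| * ε) ≤ Real.exp (κ + |κ| * ε) := by
    linarith [Real.add_one_le_exp (κ + |κ| * ε)]
  calc q * a + κ * J ≤ q * (1 + (κ + |κ| * ε)) * a := by linarith
    _ ≤ q * Real.exp (κ + |κ| * ε) * a := by gcongr
    _ ≤ 1 * Real.exp (κ + |κ| * ε) * a := by gcongr
    _ = _ := by rw [one_mul]

theorem measurable_ofReal_trace_exp_sum (hx : Measurable x) (N : ℕ) (c : ℝ) (H : Matrix n n ℝ) :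
    Measurable fun ξ : Fin N → Ω => ENNReal.ofReal
      (NormedSpace.exp (H + ∑ k, c • vecMulVec (x (ξ k)) (x (ξ k)))).trace := by
  have hc : Continuous fun w : Fin N → n → ℝ => ENNReal.ofReal
      (NormedSpace.exp (H + ∑ k, c • vecMulVec (w k) (w k))).trace :=
    ENNReal.continuous_ofReal.comp (Continuous.matrix_trace (Matrix.continuous_exp.comp
      (continuous_const.add (continuous_finsetSum _ fun k _ =>
        (continuous_const_smul c).comp
          ((continuous_apply k).matrix_vecMulVec (continuous_apply k))))))
  exact hc.measurable.comp (measurable_pi_lambda _ fun k => hx.comp (measurable_pi_apply k))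

/-- Induction on `N` with `H` arbitrary, since the first sample is absorbed into `H` before the
others are integrated out. -/
theorem lintegral_trace_exp_add_sum_le [IsFiniteMeasure ν] (hν : ν.real Set.univ ≤ 1)
    (hx : Measurable x) {R ε : ℝ} (hR : 0 < R) (hb : ∀ᵐ ω ∂ν, x ω ⬝ᵥ x ω ≤ R)
    (hcov : ∀ v : n → ℝ, |∫ ω, (x ω ⬝ᵥ v) ^ 2 ∂ν - ν.real Set.univ * (v ⬝ᵥ v)|
      ≤ ν.real Set.univ * (ε * (v ⬝ᵥ v))) {c κ : ℝ} (hκ : κ = (Real.exp (c * R) - 1) / R)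
    (N : ℕ) : ∀ {H : Matrix n n ℝ}, H.IsSymm →
    ∫⁻ ξ : Fin N → Ω, ENNReal.ofReal
        (NormedSpace.exp (H + ∑ k, c • vecMulVec (x (ξ k)) (x (ξ k)))).trace
        ∂(Measure.pi fun _ => ν)
      ≤ ENNReal.ofReal (Real.exp (κ + |κ| * ε)) ^ N
        * ENNReal.ofReal (NormedSpace.exp H).trace := by
  induction N with
  | zero => intro H _; simp
  | succ N ih =>
    intro H hH
    have hmp := measurePreserving_piFinSuccAbove (fun _ : Fin (N + 1) => ν) 0
    set g : Ω × (Fin N → Ω) → ENNReal := fun z => ENNReal.ofReal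
      (NormedSpace.exp (H + c • vecMulVec (x z.1) (x z.1)
        + ∑ k, c • vecMulVec (x (z.2 k)) (x (z.2 k)))).trace with hg
    have e : ∀ ξ : Fin (N + 1) → Ω, ENNReal.ofReal
        (NormedSpace.exp (H + ∑ k, c • vecMulVec (x (ξ k)) (x (ξ k)))).trace
        = g (MeasurableEquiv.piFinSuccAbove (fun _ => Ω) 0 ξ) := fun ξ => by
      simp only [hg, Fin.sum_univ_succ, ← add_assoc]
      rfl
    have hgm : Measurable g := by
      have := (measurable_ofReal_trace_exp_sum hx (N + 1) c H).comp
        (MeasurableEquiv.piFinSuccAbove (fun _ => Ω) 0).symm.measurable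
      convert this using 1
      funext z
      rw [Function.comp_apply, e, MeasurableEquiv.apply_symm_apply]
    simp only [e]
    rw [hmp.lintegral_comp hgm, lintegral_prod _ hgm.aemeasurable]
    calc _ ≤ ∫⁻ ω, ENNReal.ofReal (Real.exp (κ + |κ| * ε)) ^ N * ENNReal.ofReal
          (NormedSpace.exp (H + c • vecMulVec (x ω) (x ω))).trace ∂ν :=
          lintegral_mono fun ω => ih (hH.add ((isSymm_vecMulVec_self _).smul c))
      _ = ENNReal.ofReal (Real.exp (κ + |κ| * ε)) ^ N * ∫⁻ ω, ENNReal.ofReal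
          (NormedSpace.exp (H + c • vecMulVec (x ω) (x ω))).trace ∂ν :=
          lintegral_const_mul' _ _ (ENNReal.pow_ne_top ENNReal.ofReal_ne_top)
      _ ≤ _ := by
          rw [pow_succ, mul_assoc]
          gcongr
          exact lintegral_trace_exp_add_le hν hx hR hb hcov hκ hH

/-- One-sided matrix Chernoff bound: outside an event of small measure the quadratic form
`σ * ∑ₖ (x(ξₖ) ⬝ᵥ y)²` is strictly below `N (σ + t) ‖y‖²`, uniformly in `y`. -/
theorem exists_exceptional_set [Nonempty n] [IsFiniteMeasure ν] (hν : ν.real Set.univ ≤ 1)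
    (hx : Measurable x) {R ε : ℝ} (hR : 0 < R) (hε : 0 ≤ ε) (hb : ∀ᵐ ω ∂ν, x ω ⬝ᵥ x ω ≤ R)
    (hcov : ∀ v : n → ℝ, |∫ ω, (x ω ⬝ᵥ v) ^ 2 ∂ν - ν.real Set.univ * (v ⬝ᵥ v)|
      ≤ ν.real Set.univ * (ε * (v ⬝ᵥ v))) {N : ℕ} (hN : 1 ≤ N)
    {σ η : ℝ} (hσ : |σ| = 1) (hη : 0 < η) (hη1 : η ≤ 1) (t : ℝ) :
    ∃ B : Set (Fin N → Ω), (Measure.pi fun _ => ν).real B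
        ≤ Fintype.card n * Real.exp (-(N / R * (η * (t - ε) - η ^ 2 * (1 + ε)))) ∧
      ∀ ξ ∉ B, ∃ t' < t, ∀ y : n → ℝ,
        σ * ∑ k, (x (ξ k) ⬝ᵥ y) ^ 2 ≤ N * (σ + t') * (y ⬝ᵥ y) := by
  set c := σ * η / R with hc
  set κ := (Real.exp (c * R) - 1) / R with hκ
  set L := η / R * (N * (σ + t)) with hL
  set T : (Fin N → Ω) → ℝ := fun ξ =>
    (NormedSpace.exp (∑ k, c • vecMulVec (x (ξ k)) (x (ξ k)))).trace with hT
  have hsymm : ∀ ξ : Fin N → Ω, (∑ k, c • vecMulVec (x (ξ k)) (x (ξ k))).IsSymm := fun ξ =>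
    isSymm_sum_smul_vecMulVec_self _ c fun k => x (ξ k)
  have hN0 : (0 : ℝ) < N := by exact_mod_cast hN
  refine ⟨{ξ | ENNReal.ofReal (Real.exp L) ≤ ENNReal.ofReal (T ξ)}, ?_, fun ξ hξ => ?_⟩
  · have hlint := lintegral_trace_exp_add_sum_le hν hx hR hb hcov hκ N
      (H := (0 : Matrix n n ℝ)) isSymm_zero
    have hmeas := measurable_ofReal_trace_exp_sum hx N c (0 : Matrix n n ℝ)
    simp only [zero_add, NormedSpace.exp_zero, trace_one] at hlint hmeas
    have hmk := meas_ge_le_lintegral_div (μ := Measure.pi fun _ : Fin N => ν) hmeas.aemeasurable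
      (ε := ENNReal.ofReal (Real.exp L)) (by simp [Real.exp_pos]) ENNReal.ofReal_ne_top
    have hfin := hmk.trans (ENNReal.div_le_div_right hlint _)
    rw [← ENNReal.ofReal_pow (Real.exp_nonneg _), ← ENNReal.ofReal_mul (by positivity),
      ← ENNReal.ofReal_div_of_pos (Real.exp_pos _)] at hfin
    refine (ENNReal.toReal_le_of_le_ofReal (by positivity) hfin).trans ?_
    rw [← Real.exp_nat_mul, mul_comm, mul_div_assoc, ← Real.exp_sub]
    gcongr
    have hcR : c * R = σ * η := by rw [hc]; field_simp
    have hκR : κ * R = Real.exp (σ * η) - 1 := by rw [hκ, hcR]; field_simp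
    have habs : |σ * η| = η := by rw [abs_mul, hσ, one_mul, abs_of_pos hη]
    -- From `|e^z - 1 - z| ≤ z²` with `z = c R = σ η`: `κ R ≤ σ η + η²` and `|κ| R ≤ η + η²`. The
    -- terms `σ η` then cancel against the threshold `L`.
    have hexp := Real.abs_exp_sub_one_sub_id_le (x := σ * η) (by rw [habs]; exact hη1)
    have hsq : (σ * η) ^ 2 = η ^ 2 := by rw [← sq_abs, habs]
    rw [hsq] at hexp
    have h1 : κ * R ≤ σ * η + η ^ 2 := by rw [hκR]; linarith [(abs_le.1 hexp).2]
    have h2 : |κ| * R ≤ η + η ^ 2 := by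
      have e : |κ| * R = |κ * R| := by rw [abs_mul, abs_of_pos hR]
      rw [e, hκR]
      calc |Real.exp (σ * η) - 1| = |(Real.exp (σ * η) - 1 - σ * η) + σ * η| := by ring_nf
        _ ≤ _ := (abs_add_le _ _).trans (by rw [habs]; linarith)
    have h3 : |κ| * R * ε ≤ (η + η ^ 2) * ε := by gcongr
    have e : N * (κ + |κ| * ε) - L
        = N / R * (κ * R + |κ| * R * ε - η * (σ + t)) := by rw [hL]; field_simp
    rw [e, ← mul_neg]
    refine mul_le_mul_of_nonneg_left ?_ (by positivity)
    linarith
  · have hTpos : 0 < T ξ := (hsymm ξ).trace_exp_pos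
    have hlt : T ξ < Real.exp L := by
      simp only [Set.mem_ofPred_eq, not_le] at hξ
      exact (ENNReal.ofReal_lt_ofReal_iff (Real.exp_pos _)).1 hξ
    have hlog : Real.log (T ξ) < L := (Real.log_lt_iff_lt_exp hTpos).2 hlt
    -- This `t'` solves `L(t') = log (T ξ)`; strictness in `t' < t` comes from `T ξ < exp L`.
    refine ⟨R / (η * N) * Real.log (T ξ) - σ, ?_, fun y => ?_⟩
    · have : R / (η * N) * Real.log (T ξ) < R / (η * N) * L := by gcongr
      have e : R / (η * N) * L = σ + t := by rw [hL]; field_simp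
      linarith
    · have h := (hsymm ξ).dotProduct_mulVec_le_log_trace_exp y
      have e1 : y ⬝ᵥ (∑ k, c • vecMulVec (x (ξ k)) (x (ξ k))) *ᵥ y
          = c * ∑ k, (x (ξ k) ⬝ᵥ y) ^ 2 := by
        rw [sum_mulVec, dotProduct_sum, Finset.mul_sum]
        refine Finset.sum_congr rfl fun k _ => ?_
        rw [smul_mulVec, dotProduct_smul, dotProduct_vecMulVec_self_mulVec, smul_eq_mul]
      rw [e1] at h
      have h' := mul_le_mul_of_nonneg_left h (show 0 ≤ R / η by positivity)
      have e2 : R / η * (c * ∑ k, (x (ξ k) ⬝ᵥ y) ^ 2) = σ * ∑ k, (x (ξ k) ⬝ᵥ y) ^ 2 := by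
        rw [hc]; field_simp
      rw [e2] at h'
      refine h'.trans_eq ?_
      field_simp
      ring

end Chernoff

/-! ### The Hermite basis and its coherence -/

section Basis

open Matrix

open scoped Matrix

variable {d p : ℕ}

theorem measurable_hermiteON (n : ℕ) : Measurable (hermiteON n) := by
  have : Continuous fun x : ℝ => Polynomial.aeval x (Polynomial.hermite n) :=
    Polynomial.continuous_aeval _
  exact (this.div_const _).measurable

theorem measurable_psi (i : MultiIndex d p) : Measurable (psi i) :=
  Finset.measurable_prod _ fun k _ => (measurable_hermiteON _).comp (measurable_pi_apply k)

theorem hermiteON_zero (x : ℝ) : hermiteON 0 x = 1 := by simp [hermiteON]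

theorem hermiteON_one (x : ℝ) : hermiteON 1 x = x := by simp [hermiteON]

instance instIsProbabilityMeasureInputLaw (d : ℕ) : IsProbabilityMeasure (inputLaw d) := by
  unfold inputLaw; infer_instance

theorem psi_sq_le_coherence {Q : Set (Fin d → ℝ)} (h : coherence d p Q ≠ ⊤) (j : MultiIndex d p)
    {ξ : Fin d → ℝ} (hξ : ξ ∈ Q) : psi j ξ ^ 2 ≤ (coherence d p Q).toReal := by
  refine (ENNReal.ofReal_le_iff_le_toReal h).1 ?_
  exact (le_iSup (fun j : MultiIndex d p => ENNReal.ofReal (psi j ξ ^ 2)) j).trans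
    (le_iSup₂ (f := fun ξ (_ : ξ ∈ Q) => ⨆ j : MultiIndex d p, ENNReal.ofReal (psi j ξ ^ 2)) ξ hξ)

instance instNonemptyMultiIndex (d p : ℕ) : Nonempty (MultiIndex d p) :=
  ⟨⟨fun _ => 0, by simp⟩⟩

theorem numBasis_pos (d p : ℕ) : 0 < numBasis d p := Fintype.card_pos

theorem norm_sq_sampledMatrix_mulVec {N : ℕ} (ξ : Fin N → Fin d → ℝ)
    (y : EuclideanSpace ℝ (MultiIndex d p)) :
    ‖WithLp.toLp 2 ((sampledMatrix d p ξ).mulVec y.ofLp)‖ ^ 2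
      = (∑ k, (∑ j, psi j (ξ k) * y j) ^ 2) / N := by
  rw [EuclideanSpace.real_norm_sq_eq, Finset.sum_div]
  refine Finset.sum_congr rfl fun k _ => ?_
  have : (sampledMatrix d p ξ).mulVec y.ofLp k = (∑ j, psi j (ξ k) * y j) / Real.sqrt N := by
    simp only [sampledMatrix, mulVec, dotProduct, of_apply, Finset.sum_div]
    exact Finset.sum_congr rfl fun j _ => by ring
  simp only [this]
  rw [div_pow, Real.sq_sqrt (Nat.cast_nonneg N)]

/-- The infimum is meaningful because the set is bounded below: a coordinate vector, admissible as
`s ≥ 1`, forces `δ ≥ 0`. -/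
theorem ric_lt_of_bounds {m n : Type*} [Fintype m] [Fintype n] [Nonempty n] {s : ℕ} (hs : 1 ≤ s)
    {Φ : Matrix m n ℝ} {t t' : ℝ} (ht : t' < t)
    (h : ∀ y : EuclideanSpace ℝ n, {j | y j ≠ 0}.ncard ≤ s →
      (1 - t') * ‖y‖ ^ 2 ≤ ‖WithLp.toLp 2 (Φ.mulVec y.ofLp)‖ ^ 2 ∧
      ‖WithLp.toLp 2 (Φ.mulVec y.ofLp)‖ ^ 2 ≤ (1 + t') * ‖y‖ ^ 2) : ric s Φ < t := by
  classical
  rw [ric]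
  refine (csInf_le ⟨0, fun δ hδ => ?_⟩ (Set.mem_ofPred.2 h)).trans_lt ht
  obtain ⟨j⟩ := ‹Nonempty n›
  have hsub : {i | (EuclideanSpace.single j (1 : ℝ)) i ≠ 0} ⊆ {j} := fun i hi => by
    by_contra hne
    exact hi (by simp [Set.mem_singleton_iff.not.1 hne])
  have := hδ (EuclideanSpace.single j 1)
    (((Set.ncard_le_ncard hsub).trans_eq (Set.ncard_singleton j)).trans hs)
  have hn : ‖EuclideanSpace.single j (1 : ℝ)‖ = 1 := by simp
  rw [hn] at this
  linarith [this.1, this.2]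

/-- The quadratic form of the restricted Gramian deviates from that of `ℙ(Q) • 1` by at most the
truncation bias. -/
theorem abs_setIntegral_sq_sub_le {Q : Set (Fin d → ℝ)} (hQ : MeasurableSet Q)
    (hμ : coherence d p Q ≠ ⊤) (hq : (inputLaw d).real Q ≠ 0) (v : MultiIndex d p → ℝ) :
    |∫ ξ in Q, (∑ j, psi j ξ * v j) ^ 2 ∂(inputLaw d) - (inputLaw d).real Q * ∑ j, v j * v j|
      ≤ (inputLaw d).real Q * (truncBias d p Q * ∑ j, v j * v j) := by
  set q := (inputLaw d).real Q with hqdef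
  have hq0 : 0 < q := lt_of_le_of_ne measureReal_nonneg hq.symm
  have hint : ∀ i j : MultiIndex d p,
      Integrable (fun ξ => psi i ξ * psi j ξ) ((inputLaw d).restrict Q) := fun i j => by
    refine Integrable.of_bound (C := (coherence d p Q).toReal)
      ((measurable_psi i).mul (measurable_psi j)).aestronglyMeasurable ?_
    filter_upwards [ae_restrict_mem hQ] with ξ hξ
    have h1 := psi_sq_le_coherence hμ i hξ
    have h2 := psi_sq_le_coherence hμ j hξ
    rw [Real.norm_eq_abs, abs_le]
    constructor <;> nlinarith [sq_nonneg (psi i ξ + psi j ξ), sq_nonneg (psi i ξ - psi j ξ)]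
  have hcond : ∀ i j : MultiIndex d p,
      q * condGramian d p Q i j = ∫ ξ in Q, psi i ξ * psi j ξ ∂(inputLaw d) := fun i j => by
    rw [condGramian, of_apply, ProbabilityTheory.cond, integral_smul_measure, smul_eq_mul, ENNReal.toReal_inv,
      ← measureReal_def, ← hqdef, mul_inv_cancel_left₀ hq]
  have hI : ∫ ξ in Q, (∑ j, psi j ξ * v j) ^ 2 ∂(inputLaw d)
      = q * (v ⬝ᵥ condGramian d p Q *ᵥ v) := by
    have e : ∀ ξ, (∑ j, psi j ξ * v j) ^ 2
        = ∑ i, ∑ j, (v i * v j) * (psi i ξ * psi j ξ) := fun ξ => by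
      rw [sq, Finset.sum_mul_sum]
      exact Finset.sum_congr rfl fun i _ => Finset.sum_congr rfl fun j _ => by ring
    simp only [e]
    rw [integral_finsetSum _ fun i _ => integrable_finsetSum _ fun j _ =>
      (hint i j).const_mul _]
    simp only [dotProduct, mulVec, Finset.mul_sum]
    refine Finset.sum_congr rfl fun i _ => ?_
    rw [integral_finsetSum _ fun j _ => (hint i j).const_mul _]
    refine Finset.sum_congr rfl fun j _ => ?_
    rw [integral_const_mul, ← hcond]; ring
  have hone : ∑ j, v j * v j = v ⬝ᵥ (1 : Matrix (MultiIndex d p) (MultiIndex d p) ℝ) *ᵥ v := by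
    rw [one_mulVec]; rfl
  have hnorm : ∑ j, v j * v j = ‖WithLp.toLp 2 v‖ * ‖WithLp.toLp 2 v‖ := by
    rw [← sq, EuclideanSpace.real_norm_sq_eq]
    exact Finset.sum_congr rfl fun j _ => (sq _).symm
  rw [hI, ← mul_sub, abs_mul, abs_of_pos hq0]
  refine mul_le_mul_of_nonneg_left ?_ hq0.le
  conv_lhs => rw [hone]
  rw [← dotProduct_sub, ← sub_mulVec, hnorm]
  have hin := inner_toEuclideanCLM (condGramian d p Q - 1) (WithLp.toLp 2 v) (WithLp.toLp 2 v)
  rw [show v = (WithLp.toLp 2 v).ofLp from rfl, ← hin]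
  refine (abs_real_inner_le_norm _ _).trans ?_
  calc _ ≤ ‖WithLp.toLp 2 v‖ * (truncBias d p Q * ‖WithLp.toLp 2 v‖) := by
        gcongr
        exact ContinuousLinearMap.le_opNorm _ _
    _ = _ := by ring

end Basis

/-! ### Tail bounds for the restricted isometry constants -/

section Tail

open Matrix

open scoped Matrix

variable {d p : ℕ}

/-- Extending a vector on `S` by zero shows that passing to a principal submatrix does not increase
the deviation beyond `ε_Q`. -/
theorem exists_exceptional_set_of_support {Q : Set (Fin d → ℝ)} (hQ : MeasurableSet Q)
    (hμ : coherence d p Q ≠ ⊤) (hμ0 : 0 < (coherence d p Q).toReal)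
    (hq : (inputLaw d).real Q ≠ 0) {N : ℕ} (hN : 1 ≤ N)
    {S : Finset (MultiIndex d p)} (hS : S.Nonempty)
    {σ η : ℝ} (hσ : |σ| = 1) (hη : 0 < η) (hη1 : η ≤ 1) (t : ℝ) :
    ∃ B : Set (Fin N → Fin d → ℝ),
      (Measure.pi fun _ => (inputLaw d).restrict Q).real B
        ≤ S.card * Real.exp (-(N / (S.card * (coherence d p Q).toReal)
          * (η * (t - truncBias d p Q) - η ^ 2 * (1 + truncBias d p Q)))) ∧
      ∀ ξ ∉ B, ∃ t' < t, ∀ y : MultiIndex d p → ℝ, (∀ j ∉ S, y j = 0) →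
        σ * ∑ k, (∑ j, psi j (ξ k) * y j) ^ 2 ≤ N * (σ + t') * ∑ j, y j * y j := by
  have : Nonempty S := hS.to_subtype
  have hsum : ∀ (f y : MultiIndex d p → ℝ), (∀ j ∉ S, y j = 0) →
      ∑ j : S, f j * y j = ∑ j, f j * y j := fun f y hy => by
    rw [Finset.sum_coe_sort S fun j => f j * y j]
    exact Finset.sum_subset (Finset.subset_univ S) fun j _ hj => by rw [hy j hj, mul_zero]
  have hR : 0 < S.card * (coherence d p Q).toReal :=
    mul_pos (by exact_mod_cast hS.card_pos) hμ0
  obtain ⟨B, hB, hgood⟩ := exists_exceptional_set (n := S) (ν := (inputLaw d).restrict Q)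
    (x := fun ξ j => psi j.1 ξ) (R := S.card * (coherence d p Q).toReal)
    (ε := truncBias d p Q)
    (by rw [measureReal_restrict_apply_univ]; exact measureReal_le_one)
    (measurable_pi_lambda _ fun j => measurable_psi _) hR (norm_nonneg _)
    (by
      filter_upwards [ae_restrict_mem hQ] with ξ hξ
      calc _ ≤ ∑ _j : S, (coherence d p Q).toReal :=
            Finset.sum_le_sum fun j _ => by
              rw [← sq]; exact psi_sq_le_coherence hμ j.1 hξ
        _ = _ := by simp)
    (fun v => by
      set w : MultiIndex d p → ℝ := fun j => if h : j ∈ S then v ⟨j, h⟩ else 0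
      have hw : ∀ j ∉ S, w j = 0 := fun j hj => dif_neg hj
      have hwv : ∀ j : S, w j = v j := fun j => dif_pos j.2
      have h := abs_setIntegral_sq_sub_le hQ hμ hq w
      simp only [← hsum _ w hw, hwv] at h
      rw [measureReal_restrict_apply_univ]
      exact h)
    hN hσ hη hη1 t
  refine ⟨B, ?_, fun ξ hξ => ?_⟩
  · simpa using hB
  · obtain ⟨t', ht', h⟩ := hgood ξ hξ
    refine ⟨t', ht', fun y hy => ?_⟩
    have := h fun j => y j
    have e : ∀ k, ∑ j : S, psi j.1 (ξ k) * y j = ∑ j, psi j (ξ k) * y j := fun k =>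
      hsum (fun j => psi j (ξ k)) y hy
    simp only [dotProduct, hsum y y hy, e] at this
    exact this

theorem pow_sub_le_probRicLT {Q : Set (Fin d → ℝ)} (hQ : MeasurableSet Q)
    (hμ : coherence d p Q ≠ ⊤) (hμ0 : 0 < (coherence d p Q).toReal)
    (hq : (inputLaw d).real Q ≠ 0) {N : ℕ} (hN : 1 ≤ N) {s : ℕ} (hs : 1 ≤ s)
    (hsP : s ≤ numBasis d p) {η : ℝ} (hη : 0 < η) (hη1 : η ≤ 1) (t : ℝ) :
    (inputLaw d).real Q ^ N - (numBasis d p).choose s * (2 * s *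
      Real.exp (-(N / (s * (coherence d p Q).toReal)
          * (η * (t - truncBias d p Q) - η ^ 2 * (1 + truncBias d p Q)))))
      ≤ probRicLT d p N s t := by
  set E := Real.exp (-(N / (s * (coherence d p Q).toReal)
          * (η * (t - truncBias d p Q) - η ^ 2 * (1 + truncBias d p Q))))
  set ν := (inputLaw d).restrict Q
  set 𝒮 := Finset.powersetCard s (Finset.univ : Finset (MultiIndex d p))
  have hex : ∀ (σ : ℝ), |σ| = 1 → ∀ S : Finset (MultiIndex d p),
      ∃ B : Set (Fin N → Fin d → ℝ), S ∈ 𝒮 → (Measure.pi fun _ => ν).real B ≤ s * E ∧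
      ∀ ξ ∉ B, ∃ t' < t, ∀ y : MultiIndex d p → ℝ, (∀ j ∉ S, y j = 0) →
        σ * ∑ k, (∑ j, psi j (ξ k) * y j) ^ 2 ≤ N * (σ + t') * ∑ j, y j * y j := by
    intro σ hσ S
    by_cases hS : S ∈ 𝒮
    · have hcard : S.card = s := (Finset.mem_powersetCard.1 hS).2
      obtain ⟨B, h1, h2⟩ := exists_exceptional_set_of_support hQ hμ hμ0 hq hN
        (Finset.card_pos.1 (hcard ▸ hs : 0 < S.card)) hσ hη hη1 t
      rw [hcard] at h1
      exact ⟨B, fun _ => ⟨h1, h2⟩⟩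
    · exact ⟨∅, fun h => absurd h hS⟩
  choose B₁ hB₁ using hex 1 (by simp)
  choose B₂ hB₂ using hex (-1) (by simp)
  set A : Set (Fin N → Fin d → ℝ) := {ξ | ric s (sampledMatrix d p ξ) < t}
  set B := ⋃ S ∈ 𝒮, (B₁ S ∪ B₂ S)
  have hBle : (Measure.pi fun _ => ν).real B ≤ (numBasis d p).choose s * (2 * s * E) := by
    refine (measureReal_biUnion_finset_le _ _).trans ?_
    calc _ ≤ ∑ S ∈ 𝒮, 2 * s * E := Finset.sum_le_sum fun S hS => by
          refine (measureReal_union_le _ _).trans ?_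
          linarith [(hB₁ S hS).1, (hB₂ S hS).1]
      _ = _ := by
          rw [Finset.sum_const, Finset.card_powersetCard, nsmul_eq_mul]; rfl
  have hN0 : (0 : ℝ) < N := by exact_mod_cast hN
  have hgood : ∀ ξ ∉ B, ξ ∈ A := by
    intro ξ hξ
    simp only [B, Set.mem_iUnion, not_exists, Set.mem_union, not_or] at hξ
    have h2 : ∀ S : Finset (MultiIndex d p), ∃ t' < t, S ∈ 𝒮 →
        ∀ y : MultiIndex d p → ℝ, (∀ j ∉ S, y j = 0) →
        ∑ k, (∑ j, psi j (ξ k) * y j) ^ 2 ≤ N * (1 + t') * ∑ j, y j * y j ∧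
        N * (1 - t') * ∑ j, y j * y j ≤ ∑ k, (∑ j, psi j (ξ k) * y j) ^ 2 := by
      intro S
      by_cases hS : S ∈ 𝒮
      · obtain ⟨t₁, ht₁, h₁⟩ := (hB₁ S hS).2 ξ (hξ S hS).1
        obtain ⟨t₂, ht₂, h₂⟩ := (hB₂ S hS).2 ξ (hξ S hS).2
        refine ⟨max t₁ t₂, max_lt ht₁ ht₂, fun _ y hy => ?_⟩
        have hy0 : 0 ≤ N * ∑ j, y j * y j :=
          mul_nonneg hN0.le (Finset.sum_nonneg fun j _ => mul_self_nonneg _)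
        have a1 := mul_le_mul_of_nonneg_right (le_max_left t₁ t₂) hy0
        have a2 := mul_le_mul_of_nonneg_right (le_max_right t₁ t₂) hy0
        have b1 := h₁ y hy
        have b2 := h₂ y hy
        constructor <;> linarith
      · exact ⟨t - 1, by linarith, fun h => absurd h hS⟩
    choose τ hτ hτy using h2
    have hne : 𝒮.Nonempty := Finset.powersetCard_nonempty.2 hsP
    -- A maximum over finitely many supports stays strictly below `t`; smaller supports are enlarged
    -- to exactly `s` indices.
    refine ric_lt_of_bounds hs (t' := 𝒮.sup' hne τ)
      ((Finset.sup'_lt_iff hne).2 fun S _ => hτ S) fun y hy => ?_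
    obtain ⟨S, hSy, -, hS⟩ := Finset.exists_subsuperset_card_eq
      (s := (Finset.univ.filter fun j => y j ≠ 0)) (t := Finset.univ) (n := s)
      (Finset.subset_univ _) (by
        rw [← Set.ncard_coe_finset]; simpa using hy) hsP
    have hS𝒮 : S ∈ 𝒮 := Finset.mem_powersetCard.2 ⟨Finset.subset_univ _, hS⟩
    have hyS : ∀ j ∉ S, y j = 0 := fun j hj => by
      by_contra h
      exact hj (hSy (by simpa using h))
    obtain ⟨u1, u2⟩ := hτy S hS𝒮 y hyS
    have hle : τ S ≤ 𝒮.sup' hne τ := Finset.le_sup' τ hS𝒮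
    have hny : ‖y‖ ^ 2 = ∑ j, y j * y j := by
      rw [EuclideanSpace.real_norm_sq_eq]
      exact Finset.sum_congr rfl fun j _ => sq _
    have hy0 : 0 ≤ N * ∑ j, y j * y j :=
      mul_nonneg hN0.le (Finset.sum_nonneg fun j _ => mul_self_nonneg _)
    have a1 := mul_le_mul_of_nonneg_right hle hy0
    rw [norm_sq_sampledMatrix_mulVec, hny, le_div_iff₀ hN0, div_le_iff₀ hN0]
    constructor <;> linarith
  have hrestrict : (Measure.pi fun _ : Fin N => ν)
      = (Measure.pi fun _ : Fin N => inputLaw d).restrict (Set.univ.pi fun _ => Q) :=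
    (Measure.restrict_pi_pi (fun _ : Fin N => inputLaw d) fun _ => Q).symm
  -- Only the box `Q^N` needs to be measurable here, not the event `A`; the covering bound below is
  -- plain subadditivity.
  have hA : (Measure.pi fun _ : Fin N => ν).real A ≤ probRicLT d p N s t := by
    rw [hrestrict, measureReal_def, Measure.restrict_apply' (MeasurableSet.univ_pi fun _ => hQ)]
    exact measureReal_mono Set.inter_subset_left
  have huniv : (Measure.pi fun _ : Fin N => ν).real Set.univ = (inputLaw d).real Q ^ N := by
    rw [measureReal_def, Measure.pi_univ]
    simp [ν, measureReal_def]
  have hcover : (Measure.pi fun _ : Fin N => ν).real Set.univ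
      ≤ (Measure.pi fun _ : Fin N => ν).real A + (Measure.pi fun _ : Fin N => ν).real B :=
    (measureReal_mono fun ξ _ => (em (ξ ∈ B)).elim Or.inr fun h => Or.inl (hgood ξ h)).trans
      (measureReal_union_le _ _)
  linarith

/-- `P.choose s ≤ P^s / s!` and `s^s / s! ≤ e^s`. -/
theorem choose_le_exp {P s : ℕ} (hs : 1 ≤ s) (hsP : s ≤ P) :
    (P.choose s : ℝ) ≤ Real.exp (s + s * Real.log ((P : ℝ) / s)) := by
  have hs0 : (0 : ℝ) < s := by exact_mod_cast hs
  have hP0 : (0 : ℝ) < P := by exact_mod_cast hs.trans hsP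
  have h1 := Nat.choose_le_pow_div (α := ℝ) s P
  have h2 := Real.pow_div_factorial_le_exp (s : ℝ) hs0.le s
  rw [Real.exp_add, mul_comm (s : ℝ) (Real.log _), ← Real.rpow_def_of_pos (by positivity),
    Real.rpow_natCast]
  calc _ ≤ ((P : ℝ) ^ s) / s.factorial := h1
    _ = (s : ℝ) ^ s / s.factorial * ((P : ℝ) / s) ^ s := by rw [div_pow]; field_simp
    _ ≤ _ := by gcongr

end Tail

/-! ### The probabilistic bounds -/

section Bounds

variable {d p : ℕ} {Q : Set (Fin d → ℝ)}

/-- The constant in the exponent of the tail bounds, as a function of the truncation bias `ε` and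
a lower bound `τ` on the threshold. -/
noncomputable def tailConst (ε τ : ℝ) : ℝ :=
  min 1 ((τ - ε) / (2 * (1 + ε))) * (τ - ε) / (2 * τ)

theorem tailConst_pos {ε τ : ℝ} (hε : 0 ≤ ε) (hτ : ε < τ) : 0 < tailConst ε τ := by
  have h1 : 0 < τ - ε := sub_pos.2 hτ
  have h2 : 0 < τ := hε.trans_lt hτ
  have h3 : 0 < min 1 ((τ - ε) / (2 * (1 + ε))) := lt_min one_pos (by positivity)
  unfold tailConst
  positivity

/-- The choice of `η` makes `η (1 + ε) ≤ (τ - ε)/2`, so the quadratic term eats at most half of the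
linear gain; and `t - ε ≥ (1 - ε/τ) t` for `t ≥ τ`. -/
theorem tailConst_mul_le {ε τ t η : ℝ} (hε : 0 ≤ ε) (hτ : ε < τ) (ht : τ ≤ t)
    (hη : η = min 1 ((τ - ε) / (2 * (1 + ε)))) :
    tailConst ε τ * t ≤ η * (t - ε) - η ^ 2 * (1 + ε) := by
  have h1 : 0 < τ - ε := sub_pos.2 hτ
  have h2 : 0 < τ := hε.trans_lt hτ
  have hη0 : 0 < η := by rw [hη]; exact lt_min one_pos (by positivity)
  have hη1 : η * (1 + ε) ≤ (τ - ε) / 2 := by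
    have : η ≤ (τ - ε) / (2 * (1 + ε)) := hη ▸ min_le_right _ _
    rw [le_div_iff₀ (by positivity)] at this
    linarith
  have h3 : (τ - ε) / τ * t ≤ t - ε := by
    rw [div_mul_eq_mul_div, div_le_iff₀ h2]
    nlinarith
  calc tailConst ε τ * t = η / 2 * ((τ - ε) / τ * t) := by
        rw [tailConst, ← hη]; field_simp
    _ ≤ η / 2 * (t - ε) := by gcongr
    _ ≤ η * ((t - ε) - η * (1 + ε)) := by
        rw [div_mul_eq_mul_div, mul_div_assoc]
        gcongr
        linarith
    _ = _ := by ring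

theorem probRicLT_nonneg (N s : ℕ) (t : ℝ) : 0 ≤ probRicLT d p N s t := measureReal_nonneg

theorem log_terms_nonneg {P s : ℕ} (hs : 1 ≤ s) (hsP : s ≤ P) :
    0 ≤ (s : ℝ) + Real.log (2 * s) + s * Real.log ((P : ℝ) / s) := by
  have hs1 : (1 : ℝ) ≤ s := by exact_mod_cast hs
  have hsP' : (s : ℝ) ≤ P := by exact_mod_cast hsP
  have h1 : 0 ≤ Real.log (2 * s) := Real.log_nonneg (by linarith)
  have h2 : 0 ≤ Real.log ((P : ℝ) / s) := Real.log_nonneg ((one_le_div (by linarith)).2 hsP')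
  positivity

/-- The bounds hold if the probability that all samples lie in `Q` is already dominated by the
exponential term. -/
theorem ricBound_of_pow_le_exp {c t : ℝ} (h : ∀ N s : ℕ, 1 ≤ s → (inputLaw d).real Q ^ N
      ≤ Real.exp (-(c * ((N * t) / (s * (coherence d p Q).toReal))))) :
    RicBound d p Q c t := by
  intro N _
  refine ⟨fun s hs hsP => ?_, ?_⟩
  · refine le_trans (sub_nonpos.2 ((h N s hs).trans ?_)) (probRicLT_nonneg N s t)
    refine Real.exp_le_exp.2 ?_
    linarith [log_terms_nonneg hs hsP]
  · refine le_trans (sub_nonpos.2 ((h N _ (numBasis_pos d p)).trans ?_)) (probRicLT_nonneg N _ t)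
    refine le_mul_of_one_le_left (Real.exp_nonneg _) ?_
    have : (1 : ℝ) ≤ numBasis d p := by exact_mod_cast numBasis_pos d p
    linarith

theorem ricBound_of_exponent_nonpos {c t : ℝ}
    (h : ∀ N s : ℕ, c * ((N * t) / (s * (coherence d p Q).toReal)) ≤ 0) :
    RicBound d p Q c t :=
  ricBound_of_pow_le_exp fun N s _ => (pow_le_one₀ measureReal_nonneg measureReal_le_one).trans
    (Real.one_le_exp (neg_nonneg.2 (h N s)))

theorem ricBound_of_nonpos {c t : ℝ} (hc : 0 ≤ c) (ht : t ≤ 0) : RicBound d p Q c t :=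
  ricBound_of_exponent_nonpos fun N s => mul_nonpos_of_nonneg_of_nonpos hc
    (div_nonpos_of_nonpos_of_nonneg (mul_nonpos_of_nonneg_of_nonpos (Nat.cast_nonneg N) ht)
      (mul_nonneg (Nat.cast_nonneg s) ENNReal.toReal_nonneg))

theorem ricBound_of_coherence_toReal_eq_zero {c t : ℝ} (h : (coherence d p Q).toReal = 0) :
    RicBound d p Q c t :=
  ricBound_of_exponent_nonpos fun N s => by simp [h]

theorem RicBound.mono {c c' t : ℝ} (hc : c ≤ c') (ht : 0 ≤ t) (h : RicBound d p Q c' t) :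
    RicBound d p Q c t := by
  have hle : ∀ N s : ℕ, c * ((N * t) / (s * (coherence d p Q).toReal))
      ≤ c' * ((N * t) / (s * (coherence d p Q).toReal)) := fun N s =>
    mul_le_mul_of_nonneg_right hc (div_nonneg (by positivity)
      (mul_nonneg (Nat.cast_nonneg s) ENNReal.toReal_nonneg))
  intro N hN
  refine ⟨fun s hs hsP => le_trans (sub_le_sub_left (Real.exp_le_exp.2 ?_) _)
    ((h N hN).1 s hs hsP), le_trans (sub_le_sub_left ?_ _) (h N hN).2⟩
  · linarith [hle N s]
  · have := hle N (numBasis d p)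
    gcongr

theorem ricBound_tailConst (hQ : MeasurableSet Q) {τ t : ℝ} (hτ : truncBias d p Q < τ)
    (ht : τ ≤ t) : RicBound d p Q (tailConst (truncBias d p Q) τ) t := by
  set ε := truncBias d p Q
  have hε : 0 ≤ ε := norm_nonneg _
  have hC := tailConst_pos hε hτ
  -- Covers `μ_Q = ∞` as well: the exponent is then `0` and the subtracted terms are at least `1`.
  by_cases hm : (coherence d p Q).toReal = 0
  · exact ricBound_of_coherence_toReal_eq_zero hm
  have hμ : coherence d p Q ≠ ⊤ := fun h => hm (by simp [h])
  have hm0 : 0 < (coherence d p Q).toReal := lt_of_le_of_ne ENNReal.toReal_nonneg (Ne.symm hm)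
  intro N hN
  by_cases hq : (inputLaw d).real Q = 0
  · rw [hq, zero_pow (by omega)]
    exact ⟨fun s _ _ => (sub_nonpos.2 (Real.exp_nonneg _)).trans (probRicLT_nonneg N s t),
      (sub_nonpos.2 (by positivity)).trans (probRicLT_nonneg N _ t)⟩
  set η := min 1 ((τ - ε) / (2 * (1 + ε))) with hη
  have hη0 : 0 < η := lt_min one_pos (div_pos (sub_pos.2 hτ) (by positivity))
  have hexp : ∀ s : ℕ, Real.exp (-(N / (s * (coherence d p Q).toReal)
      * (η * (t - ε) - η ^ 2 * (1 + ε))))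
      ≤ Real.exp (-(tailConst ε τ * ((N * t) / (s * (coherence d p Q).toReal)))) := fun s => by
    refine Real.exp_le_exp.2 (neg_le_neg ?_)
    calc _ = N / (s * (coherence d p Q).toReal) * (tailConst ε τ * t) := by ring
      _ ≤ _ := by
        gcongr
        exact tailConst_mul_le hε hτ ht hη
  refine ⟨fun s hs hsP => le_trans (sub_le_sub_left ?_ _)
    (pow_sub_le_probRicLT hQ hμ hm0 hq hN hs hsP hη0 (min_le_left _ _) t),
    le_trans (sub_le_sub_left ?_ _) (pow_sub_le_probRicLT hQ hμ hm0 hq hN (numBasis_pos d p)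
      le_rfl hη0 (min_le_left _ _) t)⟩
  · have hs0 : (0 : ℝ) < 2 * s := by positivity
    have hsplit : Real.exp (-(tailConst ε τ * ((N * t) / (s * (coherence d p Q).toReal)))
        + s + Real.log (2 * s) + s * Real.log ((numBasis d p : ℝ) / s))
        = Real.exp (s + s * Real.log ((numBasis d p : ℝ) / s)) * (2 * s *
          Real.exp (-(tailConst ε τ * ((N * t) / (s * (coherence d p Q).toReal))))) := by
      conv_rhs => rw [← Real.exp_log hs0]
      rw [← Real.exp_add, ← Real.exp_add]
      ring_nf
    rw [hsplit]
    exact mul_le_mul (choose_le_exp hs hsP) (mul_le_mul_of_nonneg_left (hexp s) hs0.le)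
      (by positivity) (Real.exp_nonneg _)
  · rw [Nat.choose_self, Nat.cast_one, one_mul]
    exact mul_le_mul_of_nonneg_left (hexp _) (by positivity)

/-- A set of full measure has infinite coherence unless the basis is trivial. -/
theorem coherence_eq_top_of_real_eq_one (hQ : MeasurableSet Q) (hq : (inputLaw d).real Q = 1)
    (k₀ : Fin d) (hp : 1 ≤ p) : coherence d p Q = ⊤ := by
  by_contra hμ
  obtain ⟨p, rfl⟩ : ∃ r, p = r + 1 := ⟨p - 1, by omega⟩
  -- The degree-one index at `k₀`, whose basis function `ξ k₀` is unbounded on every set of full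
  -- Gaussian measure.
  set j : MultiIndex d (p + 1) := ⟨fun k => if k = k₀ then 1 else 0, by
    simp [apply_ite Fin.val]⟩
  have hj : ∀ ξ : Fin d → ℝ, psi j ξ = ξ k₀ := fun ξ => by
    rw [psi, Finset.prod_eq_single k₀]
    · simp [j, hermiteON_one]
    · intro k _ hk
      simp [j, hk, hermiteON_zero]
    · simp
  set m := (coherence d (p + 1) Q).toReal
  have hae : ∀ᵐ ξ ∂(inputLaw d), ξ ∈ Q := by
    refine (mem_ae_iff_prob_eq_one hQ).2 ?_
    rw [← ofReal_measureReal, hq, ENNReal.ofReal_one]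
  have hle : ∀ᵐ ξ ∂(inputLaw d), ξ k₀ ≤ Real.sqrt m := hae.mono fun ξ hξ => by
    have := psi_sq_le_coherence hμ j hξ
    rw [hj] at this
    exact Real.le_sqrt_of_sq_le this
  have hmp : MeasurePreserving (Function.eval k₀) (inputLaw d) (gaussianReal 0 1) :=
    measurePreserving_eval (fun _ : Fin d => gaussianReal 0 1) k₀
  have h0 : gaussianReal 0 1 (Set.Ioi (Real.sqrt m)) = 0 := by
    rw [← hmp.measure_preimage measurableSet_Ioi.nullMeasurableSet]
    refine measure_mono_null (fun ξ hξ => ?_) (ae_iff.1 hle)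
    simpa using hξ
  have := gaussianReal_absolutelyContinuous' 0 one_ne_zero h0
  simp at this

theorem ricBound_of_psi_eq_one [Subsingleton (MultiIndex d p)]
    (hψ : ∀ (j : MultiIndex d p) (ξ : Fin d → ℝ), psi j ξ = 1) {c t : ℝ} (hc : 0 ≤ c) :
    RicBound d p Q c t := by
  rcases le_or_gt t 0 with ht | ht
  · exact ricBound_of_nonpos hc ht
  have hprob : ∀ N s : ℕ, 1 ≤ N → 1 ≤ s → probRicLT d p N s t = 1 := fun N s hN hs => by
    have hN0 : (N : ℝ) ≠ 0 := by positivity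
    have huniv : {ξ : Fin N → Fin d → ℝ | ric s (sampledMatrix d p ξ) < t} = Set.univ := by
      refine Set.eq_univ_of_forall fun ξ => ric_lt_of_bounds hs ht fun y _ => ?_
      obtain ⟨j⟩ := instNonemptyMultiIndex d p
      have e : ∀ f : MultiIndex d p → ℝ, ∑ i, f i = f j := fun f => Fintype.sum_subsingleton f j
      rw [norm_sq_sampledMatrix_mulVec, EuclideanSpace.real_norm_sq_eq]
      simp only [e, hψ, one_mul, Finset.sum_const, Finset.card_univ, Fintype.card_fin,
        nsmul_eq_mul, mul_div_cancel_left₀ _ hN0, sub_zero, add_zero, le_refl, and_self]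
    rw [probRicLT, huniv, probReal_univ]
  have hq : ∀ N : ℕ, (inputLaw d).real Q ^ N ≤ 1 := fun N =>
    pow_le_one₀ measureReal_nonneg measureReal_le_one
  intro N hN
  refine ⟨fun s hs _ => ?_, ?_⟩
  · rw [hprob N s hN hs]
    exact (sub_le_self _ (Real.exp_nonneg _)).trans (hq N)
  · rw [hprob N _ hN (numBasis_pos d p)]
    exact (sub_le_self _ (by positivity)).trans (hq N)

theorem exists_ricBound (hQ : MeasurableSet Q) :
    ∃ c : ℝ, 0 < c ∧ ∀ t : ℝ, RicBound d p Q c t := by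
  by_cases hm : (coherence d p Q).toReal = 0
  · exact ⟨1, one_pos, fun t => ricBound_of_coherence_toReal_eq_zero hm⟩
  have hμ : coherence d p Q ≠ ⊤ := fun h => hm (by simp [h])
  have hm0 : 0 < (coherence d p Q).toReal := lt_of_le_of_ne ENNReal.toReal_nonneg (Ne.symm hm)
  rcases (measureReal_le_one : (inputLaw d).real Q ≤ 1).eq_or_lt with hq | hq
  · have hdp : d = 0 ∨ p = 0 := by
      by_contra! h
      exact hμ (coherence_eq_top_of_real_eq_one hQ hq ⟨0, Nat.pos_of_ne_zero h.1⟩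
        (Nat.pos_of_ne_zero h.2))
    have : Subsingleton (MultiIndex d p) := by
      refine ⟨fun i j => Subtype.ext (funext fun k => ?_)⟩
      rcases hdp with rfl | rfl
      · exact k.elim0
      · exact Fin.ext (by omega)
    refine ⟨1, one_pos, fun t => ricBound_of_psi_eq_one (fun j ξ => ?_) zero_le_one⟩
    rcases hdp with rfl | rfl
    · simp [psi]
    · simp [psi, hermiteON_zero]
  set ε := truncBias d p Q
  have hε : 0 ≤ ε := norm_nonneg _
  set q := (inputLaw d).real Q
  have hq0 : 0 ≤ q := measureReal_nonneg
  obtain ⟨r, hr, hqr⟩ : ∃ r : ℝ, 0 < r ∧ q ≤ Real.exp (-r) := by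
    rcases hq0.eq_or_lt with h | h
    · exact ⟨1, one_pos, h ▸ Real.exp_nonneg _⟩
    · exact ⟨-Real.log q, neg_pos.2 (Real.log_neg h hq), by rw [neg_neg, Real.exp_log h]⟩
  set m := (coherence d p Q).toReal
  have hc := tailConst_pos hε (lt_add_one ε)
  have hr' : 0 < r * m / (ε + 1) := by positivity
  -- The first entry serves `t ≥ ε + 1`. The second makes the exponent at most `N r` for `0 < t < ε
  -- + 1` and `s ≥ 1`, matching `q^N ≤ e^{-N r}`.
  set c := min (tailConst ε (ε + 1)) (r * m / (ε + 1))
  have hc0 : 0 < c := lt_min hc hr'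
  refine ⟨c, hc0, fun t => ?_⟩
  rcases le_or_gt t 0 with ht | ht
  · exact ricBound_of_nonpos hc0.le ht
  rcases le_or_gt (ε + 1) t with ht1 | ht1
  · exact (ricBound_tailConst hQ (lt_add_one ε) ht1).mono (min_le_left _ _) ht.le
  refine ricBound_of_pow_le_exp fun N s hs => ?_
  have hs1 : (1 : ℝ) ≤ s := by exact_mod_cast hs
  calc q ^ N ≤ Real.exp (-r) ^ N := by gcongr
    _ = Real.exp (-(N * r)) := by rw [← Real.exp_nat_mul]; ring_nf
    _ ≤ _ := by
        refine Real.exp_le_exp.2 (neg_le_neg ?_)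
        calc c * (N * t / (s * m)) ≤ (r * m / (ε + 1)) * (N * (ε + 1) / (1 * m)) := by
              gcongr
              exact min_le_right _ _
          _ = N * r := by field_simp

end Bounds

theorem theorem1 :
    ∃ C : ℝ → ℝ → ℝ, (∀ ε τ : ℝ, 0 ≤ ε → ε < τ → 0 < C ε τ) ∧
      ∀ (d p : ℕ) (Q : Set (Fin d → ℝ)), MeasurableSet Q →
        (∀ τ t : ℝ, truncBias d p Q < τ → τ ≤ t →
          RicBound d p Q (C (truncBias d p Q) τ) t) ∧
        (∃ c : ℝ, 0 < c ∧ ∀ t : ℝ, RicBound d p Q c t) :=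
  ⟨tailConst, fun _ _ => tailConst_pos, fun _ _ _ hQ =>
    ⟨fun _ _ => ricBound_tailConst hQ, exists_ricBound hQ⟩⟩
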